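/- Let $A$ be an associative ring with unit and let $\mathcal C$ be an $A$-coring, i.e. an $(A,A)$-bimodule with a coassociative $(A,A)$-bimodule coproduct $\Delta:\mathcal C\to\mathcal C\otimes_A\mathcal C$, $\Delta(c)=\sum c_{(1)}\otimes c_{(2)}$, and a counit $\varepsilon:\mathcal C\to A$, an $(A,A)$-bimodule map with $\sum\varepsilon(c_{(1)})c_{(2)}=c=\sum c_{(1)}\varepsilon(c_{(2)})$. The coring $\mathcal C$ is called coseparable if there is a $(\mathcal C,\mathcal C)$-bicomodule map $\pi:\mathcal C\otimes_A\mathcal C\to\mathcal C$ with $\pi\circ\Delta=\mathrm{id}_{\mathcal C}$, where $\mathcal C\otimes_A\mathcal C$ has the left coaction $\Delta\otimes\mathrm{id}$ and the right coaction $\mathrm{id}\otimes\Delta$, and $\mathcal C$ has both coactions equal to $\Delta$. Let ${}^*\mathcal C$ be the set of left $A$-module maps $\mathcal C\to A$, a ring under pointwise addition, the product $(\xi\xi')(c)=\sum\xi'(c_{(1)}\xi(c_{(2)}))$ and the unit $\varepsilon$, and let ${}^*\iota:A\to{}^*\mathcal C$ be the ring map ${}^*\iota(a)(c)=\varepsilon(ca)$.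 Let $\mathcal C^*$ be the set of right $A$-module maps $\mathcal C\to A$, a ring under pointwise addition, the product $(\xi\xi')(c)=\sum\xi(\xi'(c_{(1)})c_{(2)})$ and the unit $\varepsilon$, and let $\iota^*:A\to\mathcal C^*$ be the ring map $\iota^*(a)(c)=\varepsilon(ac)$. A ring map $A\to B$ is called a separable extension if the multiplication map $B\otimes_A B\to B$ has a $(B,B)$-bimodule section. 1. If $\mathcal C$ is finitely generated projective as a left $A$-module, then $\mathcal C$ is coseparable if and only if ${}^*\iota:A\to{}^*\mathcal C$ is a separable extension. 2. If $\mathcal C$ is finitely generated projective as a right $A$-module, then $\mathcal C$ is coseparable if and only if $\iota^*:A\to\mathcal C^*$ is a separable extension. -/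

import Mathlib

/-!
Bimodules over a (noncommutative) ring `A` are additive groups with commuting actions of `A`
(left action) and of `Aᵐᵒᵖ` (right action, `m a = MulOpposite.op a • m`).
-/

noncomputable section

namespace Corings

open scoped TensorProduct
open MulOpposite

/-! ### Tensor product over a noncommutative ring -/

/-- The relations `(m a) ⊗ n - m ⊗ (a n)` inside `M ⊗[ℤ] N`. -/
def balancedRel (A : Type*) [Ring A] (M N : Type*) [AddCommGroup M] [AddCommGroup N]
    [Module Aᵐᵒᵖ M] [Module A N] : Submodule ℤ (M ⊗[ℤ] N) :=
  Submodule.span ℤ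
    {x | ∃ (m : M) (a : A) (n : N), x = (op a • m) ⊗ₜ[ℤ] n - m ⊗ₜ[ℤ] (a • n)}

/-- The tensor product `M ⊗_A N` of a right `A`-module `M` and a left `A`-module `N`. -/
def Tens (A : Type*) [Ring A] (M N : Type*) [AddCommGroup M] [AddCommGroup N]
    [Module Aᵐᵒᵖ M] [Module A N] : Type _ :=
  (M ⊗[ℤ] N) ⧸ balancedRel A M N

namespace Tens

section Basic

variable {A : Type*} [Ring A] {M N P : Type*} [AddCommGroup M] [AddCommGroup N]
  [AddCommGroup P] [Module Aᵐᵒᵖ M] [Module A N]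

instance : AddCommGroup (Tens A M N) :=
  inferInstanceAs (AddCommGroup ((M ⊗[ℤ] N) ⧸ balancedRel A M N))

/-- The pure tensor `m ⊗ n` in `M ⊗_A N`. -/
def tmul (A : Type*) [Ring A] {M N : Type*} [AddCommGroup M] [AddCommGroup N]
    [Module Aᵐᵒᵖ M] [Module A N] (m : M) (n : N) : Tens A M N :=
  Submodule.Quotient.mk (p := balancedRel A M N) (m ⊗ₜ[ℤ] n)

theorem smul_tmul (m : M) (a : A) (n : N) : tmul A (op a • m) n = tmul A m (a • n) :=
  (Submodule.Quotient.eq _).2 (Submodule.subset_span ⟨m, a, n, rfl⟩)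

theorem add_tmul (m m' : M) (n : N) : tmul A (m + m') n = tmul A m n + tmul A m' n :=
  congrArg (Submodule.Quotient.mk (p := balancedRel A M N)) (TensorProduct.add_tmul m m' n)

theorem tmul_add (m : M) (n n' : N) : tmul A m (n + n') = tmul A m n + tmul A m n' :=
  congrArg (Submodule.Quotient.mk (p := balancedRel A M N)) (TensorProduct.tmul_add m n n')

/-- A biadditive function, as a bundled map. -/
def biadd {M N P : Type*} [AddCommGroup M] [AddCommGroup N] [AddCommGroup P] (f : M → N → P)
    (h1 : ∀ m m' n, f (m + m') n = f m n + f m' n)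
    (h2 : ∀ m n n', f m (n + n') = f m n + f m n') : M →+ N →+ P :=
  AddMonoidHom.mk' (fun m => AddMonoidHom.mk' (f m) (h2 m))
    (fun m m' => AddMonoidHom.ext fun n => h1 m m' n)

@[simp] theorem biadd_apply {M N P : Type*} [AddCommGroup M] [AddCommGroup N]
    [AddCommGroup P] (f : M → N → P) (h1 h2) (m : M) (n : N) : biadd f h1 h2 m n = f m n := rfl

/-- `tmul` as a biadditive map. -/
def tmulHom (A : Type*) [Ring A] (M N : Type*) [AddCommGroup M] [AddCommGroup N]
    [Module Aᵐᵒᵖ M] [Module A N] : M →+ N →+ Tens A M N :=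
  biadd (fun m n => tmul A m n) add_tmul tmul_add

@[simp] theorem tmulHom_apply (m : M) (n : N) : tmulHom A M N m n = tmul A m n := rfl

@[simp] theorem zero_tmul (n : N) : tmul A (0 : M) n = 0 :=
  DFunLike.congr_fun (map_zero (tmulHom A M N)) n

@[simp] theorem tmul_zero (m : M) : tmul A m (0 : N) = 0 :=
  map_zero (tmulHom A M N m)

theorem induction_on {p : Tens A M N → Prop} (x : Tens A M N) (h0 : p 0)
    (ht : ∀ m n, p (tmul A m n)) (ha : ∀ x y, p x → p y → p (x + y)) : p x := by
  obtain ⟨y, rfl⟩ := Submodule.Quotient.mk_surjective (balancedRel A M N) x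
  induction y using TensorProduct.induction_on with
  | zero => exact h0
  | tmul m n => exact ht m n
  | add y z hy hz => exact ha _ _ hy hz

/-- The additive map `M ⊗_A N → P` induced by an `A`-balanced biadditive map. -/
def lift (f : M →+ N →+ P) (hf : ∀ m (a : A) n, f (op a • m) n = f m (a • n)) :
    Tens A M N →+ P :=
  ((balancedRel A M N).liftQ
    (TensorProduct.liftAddHom (R := ℤ) f (fun r m n => by simp)).toIntLinearMap
    (by
      rw [balancedRel, Submodule.span_le]
      rintro x ⟨m, a, n, rfl⟩
      simp [hf])).toAddMonoidHom

@[simp] theorem lift_tmul (f : M →+ N →+ P)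
    (hf : ∀ m (a : A) n, f (op a • m) n = f m (a • n)) (m : M) (n : N) :
    lift f hf (tmul A m n) = f m n :=
  rfl

theorem hom_ext {f g : Tens A M N →+ P} (h : ∀ m n, f (tmul A m n) = g (tmul A m n)) :
    f = g := by
  ext x
  induction x using induction_on with
  | h0 => simp
  | ht m n => exact h m n
  | ha x y hx hy => simp [hx, hy]

variable {M' N' M'' N'' : Type*} [AddCommGroup M'] [AddCommGroup N'] [Module Aᵐᵒᵖ M']
  [Module A N'] [AddCommGroup M''] [AddCommGroup N''] [Module Aᵐᵒᵖ M''] [Module A N'']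

/-- `f ⊗ g` for a right `A`-linear map `f` and a left `A`-linear map `g`. -/
def map (f : M →ₗ[Aᵐᵒᵖ] M') (g : N →ₗ[A] N') : Tens A M N →+ Tens A M' N' :=
  lift
    (biadd (fun m n => tmul A (f m) (g n))
      (fun m m' n => by rw [map_add, add_tmul]) (fun m n n' => by rw [map_add, tmul_add]))
    (fun m a n => by
      change tmul A (f (op a • m)) (g n) = tmul A (f m) (g (a • n))
      rw [map_smul, map_smul, smul_tmul])

@[simp] theorem map_tmul (f : M →ₗ[Aᵐᵒᵖ] M') (g : N →ₗ[A] N') (m : M) (n : N) :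
    map f g (tmul A m n) = tmul A (f m) (g n) := rfl

theorem map_map (f : M →ₗ[Aᵐᵒᵖ] M') (g : N →ₗ[A] N') (f' : M' →ₗ[Aᵐᵒᵖ] M'')
    (g' : N' →ₗ[A] N'') (x : Tens A M N) :
    map f' g' (map f g x) = map (f' ∘ₗ f) (g' ∘ₗ g) x :=
  DFunLike.congr_fun (hom_ext (f := (map f' g').comp (map f g))
    (g := map (f' ∘ₗ f) (g' ∘ₗ g)) fun _ _ => rfl) x

theorem map_id (x : Tens A M N) :
    map (LinearMap.id : M →ₗ[Aᵐᵒᵖ] M) (LinearMap.id : N →ₗ[A] N) x = x :=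
  DFunLike.congr_fun (hom_ext (f := map LinearMap.id LinearMap.id)
    (g := AddMonoidHom.id _) fun _ _ => rfl) x

theorem map_add_left (f f' : M →ₗ[Aᵐᵒᵖ] M') (g : N →ₗ[A] N') (x : Tens A M N) :
    map (f + f') g x = map f g x + map f' g x :=
  DFunLike.congr_fun (hom_ext (g := map f g + map f' g) fun m n => by simp [add_tmul]) x

theorem map_add_right (f : M →ₗ[Aᵐᵒᵖ] M') (g g' : N →ₗ[A] N') (x : Tens A M N) :
    map f (g + g') x = map f g x + map f g' x :=
  DFunLike.congr_fun (hom_ext (g := map f g + map f g') fun m n => by simp [tmul_add]) x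

end Basic

/-! ### Actions on the outer sides of a tensor product -/

section LeftAction

variable {S A : Type*} [Ring S] [Ring A] {M N : Type*} [AddCommGroup M] [AddCommGroup N]
  [Module Aᵐᵒᵖ M] [Module A N] [Module S M] [SMulCommClass S Aᵐᵒᵖ M]

/-- `s (m ⊗ n) = (s m) ⊗ n` for an `(S, A)`-bimodule `M`. -/
instance leftModule : Module S (Tens A M N) where
  smul s x := map (DistribSMul.toLinearMap Aᵐᵒᵖ M s) LinearMap.id x
  one_smul x := by
    change map _ _ x = x
    conv_rhs => rw [← map_id x]
    congr 2; ext; simp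
  mul_smul s t x := by
    change map _ _ x = map _ _ (map _ _ x)
    rw [map_map]
    congr 2; ext; simp [mul_smul]
  smul_zero s := by exact AddMonoidHom.map_zero _
  smul_add s x y := by exact AddMonoidHom.map_add _ x y
  add_smul s t x := by
    change map _ _ x = map _ _ x + map _ _ x
    rw [← map_add_left]
    congr 2; ext; simp [add_smul]
  zero_smul x := by
    change map _ _ x = 0
    refine DFunLike.congr_fun (hom_ext (g := 0) fun m n => ?_) x
    simp

@[simp] theorem left_smul_tmul (s : S) (m : M) (n : N) :
    s • tmul A m n = tmul A (s • m) n := rfl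

end LeftAction

section RightAction

variable {S A : Type*} [Ring S] [Ring A] {M N : Type*} [AddCommGroup M] [AddCommGroup N]
  [Module Aᵐᵒᵖ M] [Module A N] [Module Sᵐᵒᵖ N] [SMulCommClass A Sᵐᵒᵖ N]

/-- `(m ⊗ n) s = m ⊗ (n s)` for an `(A, S)`-bimodule `N`. -/
instance rightModule : Module Sᵐᵒᵖ (Tens A M N) where
  smul s x := map LinearMap.id
    (haveI := SMulCommClass.symm A Sᵐᵒᵖ N; DistribSMul.toLinearMap A N s) x
  one_smul x := by
    change map _ _ x = x
    conv_rhs => rw [← map_id x]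
    congr 2; ext; simp
  mul_smul s t x := by
    change map _ _ x = map _ _ (map _ _ x)
    rw [map_map]
    congr 2; ext; simp [mul_smul]
  smul_zero s := by exact AddMonoidHom.map_zero _
  smul_add s x y := by exact AddMonoidHom.map_add _ x y
  add_smul s t x := by
    change map _ _ x = map _ _ x + map _ _ x
    rw [← map_add_right]
    congr 2; ext; simp [add_smul]
  zero_smul x := by
    change map _ _ x = 0
    refine DFunLike.congr_fun (hom_ext (g := 0) fun m n => ?_) x
    simp

@[simp] theorem right_smul_tmul (s : Sᵐᵒᵖ) (m : M) (n : N) :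
    s • tmul A m n = tmul A m (s • n) := rfl

end RightAction

instance smulCommClass {S T A : Type*} [Ring S] [Ring T] [Ring A] {M N : Type*}
    [AddCommGroup M] [AddCommGroup N] [Module Aᵐᵒᵖ M] [Module A N] [Module S M]
    [SMulCommClass S Aᵐᵒᵖ M] [Module Tᵐᵒᵖ N] [SMulCommClass A Tᵐᵒᵖ N] :
    @SMulCommClass S Tᵐᵒᵖ (Tens A M N) leftModule.toSMul rightModule.toSMul := by
  let i1 : Module S (Tens A M N) := leftModule
  let i2 : Module Tᵐᵒᵖ (Tens A M N) := rightModule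
  refine ⟨fun s t x => ?_⟩
  induction x using induction_on with
  | h0 => rw [smul_zero, smul_zero, smul_zero]
  | ht m n => rfl
  | ha x y hx hy => rw [smul_add, smul_add, smul_add, smul_add, hx, hy]

/-! ### Associativity and unit maps -/

section Assoc

variable {A : Type*} [Ring A] {M N P : Type*} [AddCommGroup M] [AddCommGroup N]
  [AddCommGroup P] [Module Aᵐᵒᵖ M] [Module A N] [Module Aᵐᵒᵖ N] [SMulCommClass A Aᵐᵒᵖ N]
  [Module A P]

/-- `m ⊗ n ↦ m ⊗ (n ⊗ p)` -/
def assocHomAux (p : P) : Tens A M N →+ Tens A M (Tens A N P) :=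
  lift
    (biadd (fun m n => tmul A m (tmul A n p)) (fun m m' n => add_tmul m m' _)
      (fun m n n' => by rw [add_tmul, tmul_add]))
    (fun m a n => smul_tmul m a (tmul A n p))

/-- `(m ⊗ n) ⊗ p ↦ m ⊗ (n ⊗ p)` -/
def assocHom : Tens A (Tens A M N) P →+ Tens A M (Tens A N P) :=
  lift
    (biadd (fun x p => assocHomAux p x) (fun x x' p => map_add _ x x')
      (fun x p p' => DFunLike.congr_fun (hom_ext (f := assocHomAux (p + p'))
        (g := assocHomAux p + assocHomAux p') fun m n =>
          (congrArg (tmul A m) (tmul_add n p p')).trans (tmul_add m _ _)) x))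
    (fun x a p => by
      change assocHomAux p (op a • x) = assocHomAux (a • p) x
      induction x using induction_on with
      | h0 => rw [smul_zero, map_zero, map_zero]
      | ht m n => exact congrArg (tmul A m) (smul_tmul n a p)
      | ha x y hx hy => rw [smul_add, map_add, map_add, hx, hy])

@[simp] theorem assocHom_tmul (m : M) (n : N) (p : P) :
    assocHom (tmul A (tmul A m n) p) = tmul A m (tmul A n p) := rfl

/-- `n ⊗ p ↦ (m ⊗ n) ⊗ p` -/
def assocInvAux (m : M) : Tens A N P →+ Tens A (Tens A M N) P :=
  lift
    (biadd (fun n p => tmul A (tmul A m n) p) (fun n n' p => by rw [tmul_add, add_tmul])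
      (fun n p p' => tmul_add _ p p'))
    (fun n a p => smul_tmul (tmul A m n) a p)

/-- `m ⊗ (n ⊗ p) ↦ (m ⊗ n) ⊗ p` -/
def assocInv : Tens A M (Tens A N P) →+ Tens A (Tens A M N) P :=
  lift
    (biadd (fun m y => assocInvAux m y)
      (fun m m' y => DFunLike.congr_fun (hom_ext (f := assocInvAux (m + m'))
        (g := assocInvAux m + assocInvAux m') fun n p =>
          (congrArg (fun x => tmul A x p) (add_tmul m m' n)).trans (add_tmul _ _ p)) y)
      (fun m y y' => map_add _ y y'))
    (fun m a y => by
      change assocInvAux (op a • m) y = assocInvAux m (a • y)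
      induction y using induction_on with
      | h0 => rw [smul_zero, map_zero, map_zero]
      | ht n p => exact congrArg (fun x => tmul A x p) (smul_tmul m a n)
      | ha x y hx hy => rw [smul_add, map_add, map_add, hx, hy])

@[simp] theorem assocInv_tmul (m : M) (n : N) (p : P) :
    assocInv (tmul A m (tmul A n p)) = tmul A (tmul A m n) p := rfl

/-- The canonical isomorphism `(M ⊗_A N) ⊗_A P ≃ M ⊗_A (N ⊗_A P)`. -/
def assoc (A : Type*) [Ring A] (M N P : Type*) [AddCommGroup M] [AddCommGroup N]
    [AddCommGroup P] [Module Aᵐᵒᵖ M] [Module A N] [Module Aᵐᵒᵖ N] [SMulCommClass A Aᵐᵒᵖ N]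
    [Module A P] : Tens A (Tens A M N) P ≃+ Tens A M (Tens A N P) where
  toFun := assocHom
  invFun := assocInv
  map_add' := map_add _
  left_inv x := by
    induction x using induction_on with
    | h0 => simp
    | ht x p =>
      induction x using induction_on with
      | h0 => rw [zero_tmul, map_zero, map_zero]
      | ht m n => rfl
      | ha x y hx hy => rw [add_tmul, map_add, map_add, hx, hy]
    | ha x y hx hy => rw [map_add, map_add, hx, hy]
  right_inv x := by
    induction x using induction_on with
    | h0 => simp
    | ht m x =>
      induction x using induction_on with
      | h0 => rw [tmul_zero, map_zero, map_zero]
      | ht m n => rfl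
      | ha x y hx hy => rw [tmul_add, map_add, map_add, hx, hy]
    | ha x y hx hy => rw [map_add, map_add, hx, hy]

@[simp] theorem assoc_tmul (m : M) (n : N) (p : P) :
    assoc A M N P (tmul A (tmul A m n) p) = tmul A m (tmul A n p) := rfl

@[simp] theorem assoc_symm_tmul (m : M) (n : N) (p : P) :
    (assoc A M N P).symm (tmul A m (tmul A n p)) = tmul A (tmul A m n) p := rfl

end Assoc

section Contract

variable {A : Type*} [Ring A] {C M : Type*} [AddCommGroup C] [AddCommGroup M]

/-- `m ⊗ c ↦ m ξ(c)`, for a left `A`-linear `ξ : C → A`. -/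
def contractRight [Module Aᵐᵒᵖ M] [Module A C] (ξ : C →ₗ[A] A) : Tens A M C →+ M :=
  lift
    (AddMonoidHom.mk'
      (fun m => AddMonoidHom.mk' (fun c => op (ξ c) • m)
        (fun c c' => by rw [map_add, op_add, add_smul]))
      (fun m m' => by ext c; simp))
    (fun m a c => by simp [mul_smul])

@[simp] theorem contractRight_tmul [Module Aᵐᵒᵖ M] [Module A C] (ξ : C →ₗ[A] A) (m : M)
    (c : C) : contractRight ξ (tmul A m c) = op (ξ c) • m := rfl

/-- `c ⊗ m ↦ ξ(c) m`, for a right `A`-linear `ξ : C → A`. -/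
def contractLeft [Module A M] [Module Aᵐᵒᵖ C] (ξ : C →ₗ[Aᵐᵒᵖ] A) : Tens A C M →+ M :=
  lift
    (AddMonoidHom.mk'
      (fun c => AddMonoidHom.mk' (fun m => ξ c • m) (fun m m' => smul_add _ _ _))
      (fun c c' => by ext m; simp [add_smul]))
    (fun c a m => by simp [mul_smul])

@[simp] theorem contractLeft_tmul [Module A M] [Module Aᵐᵒᵖ C] (ξ : C →ₗ[Aᵐᵒᵖ] A) (m : M)
    (c : C) : contractLeft ξ (tmul A c m) = ξ c • m := rfl

end Contract

end Tens

/-! ### Bimodule maps -/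

/-- `(A, B)`-bimodule maps `M → N`. -/
structure BimodHom (A B : Type*) [Ring A] [Ring B] (M N : Type*) [AddCommGroup M]
    [AddCommGroup N] [Module A M] [Module Bᵐᵒᵖ M] [Module A N] [Module Bᵐᵒᵖ N]
    extends M →+ N where
  map_left_smul : ∀ (a : A) (m : M), toFun (a • m) = a • toFun m
  map_right_smul : ∀ (b : B) (m : M), toFun (op b • m) = op b • toFun m

namespace BimodHom

variable {A B : Type*} [Ring A] [Ring B] {M N : Type*} [AddCommGroup M]
  [AddCommGroup N] [Module A M] [Module Bᵐᵒᵖ M] [Module A N] [Module Bᵐᵒᵖ N]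

instance : FunLike (BimodHom A B M N) M N where
  coe f := f.toFun
  coe_injective f g h := by
    cases f; cases g; congr 1; exact DFunLike.coe_injective h

instance : AddMonoidHomClass (BimodHom A B M N) M N where
  map_add f := f.map_add'
  map_zero f := f.map_zero'

theorem map_smul_left (f : BimodHom A B M N) (a : A) (m : M) : f (a • m) = a • f m :=
  f.map_left_smul a m

theorem map_smul_right (f : BimodHom A B M N) (b : B) (m : M) :
    f (op b • m) = op b • f m :=
  f.map_right_smul b m

/-- A bimodule map as a left linear map. -/
def left (f : BimodHom A B M N) : M →ₗ[A] N where
  toFun := f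
  map_add' := f.map_add'
  map_smul' := f.map_left_smul

/-- A bimodule map as a right linear map. -/
def right (f : BimodHom A B M N) : M →ₗ[Bᵐᵒᵖ] N where
  toFun := f
  map_add' := f.map_add'
  map_smul' b m := f.map_right_smul b.unop m

@[simp] theorem left_apply (f : BimodHom A B M N) (m : M) : f.left m = f m := rfl

@[simp] theorem right_apply (f : BimodHom A B M N) (m : M) : f.right m = f m := rfl

end BimodHom

/-! ### Corings -/

/-- An `A`-coring structure (coassociative and counital) on an `(A, A)`-bimodule `C`. -/
class Coring (A : Type*) (C : Type*) [Ring A] [AddCommGroup C] [Module A C] [Module Aᵐᵒᵖ C]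
    [SMulCommClass A Aᵐᵒᵖ C] where
  /-- the coproduct -/
  comul : BimodHom A A C (Tens A C C)
  /-- the counit -/
  counit : BimodHom A A C A
  coassoc : ∀ c : C,
    Tens.assoc A C C C (Tens.map comul.right (LinearMap.id : C →ₗ[A] C) (comul c)) =
      Tens.map (LinearMap.id : C →ₗ[Aᵐᵒᵖ] C) comul.left (comul c)
  /-- `∑ ε(c₁) c₂ = c` -/
  counit_comul : ∀ c : C, Tens.contractLeft counit.right (comul c) = c
  /-- `∑ c₁ ε(c₂) = c` -/
  comul_counit : ∀ c : C, Tens.contractRight counit.left (comul c) = c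

section CoringDefs

variable (A : Type*) (C : Type*) [Ring A] [AddCommGroup C] [Module A C] [Module Aᵐᵒᵖ C]
  [SMulCommClass A Aᵐᵒᵖ C]

/-- The right coaction `I ⊗ Δ` on `C ⊗_A C`. -/
def tensRightCoaction [Coring A C] : Tens A C C →+ Tens A (Tens A C C) C :=
  (Tens.assoc A C C C).symm.toAddMonoidHom.comp
    (Tens.map LinearMap.id (Coring.comul (A := A) (C := C)).left)

/-- The left coaction `Δ ⊗ I` on `C ⊗_A C`. -/
def tensLeftCoaction [Coring A C] : Tens A C C →+ Tens A C (Tens A C C) :=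
  (Tens.assoc A C C C).toAddMonoidHom.comp
    (Tens.map (Coring.comul (A := A) (C := C)).right LinearMap.id)

variable {A C}

/-- `f : M → N` is colinear for the right coactions `ρM`, `ρN`, that is
`ρN ∘ f = (f ⊗ I) ∘ ρM`. -/
def IsRightColinear {M N : Type*} [AddCommGroup M] [AddCommGroup N] [Module Aᵐᵒᵖ M]
    [Module Aᵐᵒᵖ N] (ρM : M →+ Tens A M C) (ρN : N →+ Tens A N C) (f : M →ₗ[Aᵐᵒᵖ] N) : Prop :=
  ∀ m : M, ρN (f m) = Tens.map f (LinearMap.id : C →ₗ[A] C) (ρM m)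

/-- `f : M → N` is colinear for the left coactions `lM`, `lN`, that is
`lN ∘ f = (I ⊗ f) ∘ lM`. -/
def IsLeftColinear {M N : Type*} [AddCommGroup M] [AddCommGroup N] [Module A M]
    [Module A N] (lM : M →+ Tens A C M) (lN : N →+ Tens A C N) (f : M →ₗ[A] N) : Prop :=
  ∀ m : M, lN (f m) = Tens.map (LinearMap.id : C →ₗ[Aᵐᵒᵖ] C) f (lM m)

variable (A C)

/-- `C` is coseparable: the coproduct has a splitting `π : C ⊗_A C → C` that is a map of
`(C, C)`-bicomodules, for the coactions `Δ ⊗ I`, `I ⊗ Δ` on `C ⊗_A C` and `Δ`, `Δ` on `C`. -/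
def IsCoseparable [Coring A C] : Prop :=
  ∃ π : BimodHom A A (Tens A C C) C,
    IsLeftColinear (tensLeftCoaction A C) (Coring.comul (A := A) (C := C)).toAddMonoidHom
      π.left ∧
    IsRightColinear (tensRightCoaction A C) (Coring.comul (A := A) (C := C)).toAddMonoidHom
      π.right ∧
    ∀ c : C, π (Coring.comul (A := A) c) = c

end CoringDefs

/-! ### The left dual ring -/

/-- `*C`, the left `A`-linear maps `C → A`. -/
def LeftDual (A : Type*) (C : Type*) [Ring A] [AddCommGroup C] [Module A C] : Type _ :=
  C →ₗ[A] A

/-- `C*`, the right `A`-linear maps `C → A`. -/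
def RightDual (A : Type*) (C : Type*) [Ring A] [AddCommGroup C] [Module Aᵐᵒᵖ C] : Type _ :=
  C →ₗ[Aᵐᵒᵖ] A

section Duals

variable {A : Type*} {C : Type*} [Ring A] [AddCommGroup C] [Module A C] [Module Aᵐᵒᵖ C]
  [SMulCommClass A Aᵐᵒᵖ C]

instance : AddCommGroup (LeftDual A C) := inferInstanceAs (AddCommGroup (C →ₗ[A] A))

instance : AddCommGroup (RightDual A C) := inferInstanceAs (AddCommGroup (C →ₗ[Aᵐᵒᵖ] A))

/-- An element of `*C` as a linear map. -/
def LeftDual.toLin (ξ : LeftDual A C) : C →ₗ[A] A := ξ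

/-- An element of `C*` as a linear map. -/
def RightDual.toLin (ξ : RightDual A C) : C →ₗ[Aᵐᵒᵖ] A := ξ

/-- `c ⊗ c' ↦ c ξ(c')` as a left linear map. -/
def contractRightLin (ξ : C →ₗ[A] A) : Tens A C C →ₗ[A] C where
  toFun := Tens.contractRight ξ
  map_add' := map_add _
  map_smul' a x := by
    induction x using Tens.induction_on with
    | h0 => simp
    | ht c c' => simp [smul_comm]
    | ha x y hx hy => rw [smul_add, map_add, map_add, hx, hy, smul_add]

/-- `c ⊗ c' ↦ ξ(c) c'` as a right linear map. -/
def contractLeftLin (ξ : C →ₗ[Aᵐᵒᵖ] A) : Tens A C C →ₗ[Aᵐᵒᵖ] C where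
  toFun := Tens.contractLeft ξ
  map_add' := map_add _
  map_smul' a x := by
    induction x using Tens.induction_on with
    | h0 => simp
    | ht c c' => simp [smul_comm]
    | ha x y hx hy => rw [smul_add, map_add, map_add, hx, hy, smul_add]

variable [Coring A C]

/-- `(ξ ξ')(c) = ∑ ξ'(c₁ ξ(c₂))` -/
def LeftDual.mul (ξ ξ' : LeftDual A C) : LeftDual A C :=
  ξ'.toLin.comp ((contractRightLin ξ.toLin).comp (Coring.comul (A := A) (C := C)).left)

/-- `(ξ ξ')(c) = ∑ ξ(ξ'(c₁) c₂)` -/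
def RightDual.mul (ξ ξ' : RightDual A C) : RightDual A C :=
  ξ.toLin.comp ((contractLeftLin ξ'.toLin).comp (Coring.comul (A := A) (C := C)).right)

theorem LeftDual.ext {ξ η : LeftDual A C} (h : ∀ c, ξ.toLin c = η.toLin c) : ξ = η :=
  LinearMap.ext h

theorem RightDual.ext {ξ η : RightDual A C} (h : ∀ c, ξ.toLin c = η.toLin c) : ξ = η :=
  LinearMap.ext h

theorem LeftDual.mul_def (ξ ξ' : LeftDual A C) (c : C) :
    (LeftDual.mul ξ ξ').toLin c =
      ξ'.toLin (Tens.contractRight ξ.toLin (Coring.comul (A := A) c)) := rfl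

theorem RightDual.mul_def (ξ ξ' : RightDual A C) (c : C) :
    (RightDual.mul ξ ξ').toLin c =
      ξ.toLin (Tens.contractLeft ξ'.toLin (Coring.comul (A := A) c)) := rfl

theorem LeftDual.mul_assoc' (ξ η ζ : LeftDual A C) :
    LeftDual.mul (LeftDual.mul ξ η) ζ = LeftDual.mul ξ (LeftDual.mul η ζ) := by
  apply LeftDual.ext
  intro c
  rw [mul_def, mul_def, mul_def]
  congr 1
  let D := Coring.comul (A := A) (C := C)
  have h1 : ∀ x : Tens A C C, Tens.contractRight (M := C) (LeftDual.mul ξ η).toLin x =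
      Tens.contractRight η.toLin (Tens.map LinearMap.id (contractRightLin ξ.toLin)
        (Tens.map LinearMap.id D.left x)) := fun x =>
    DFunLike.congr_fun (Tens.hom_ext
      (f := Tens.contractRight (M := C) (LeftDual.mul ξ η).toLin)
      (g := (Tens.contractRight η.toLin).comp
        ((Tens.map LinearMap.id (contractRightLin ξ.toLin)).comp
          (Tens.map LinearMap.id D.left))) fun _ _ => rfl) x
  have h2 : ∀ x : Tens A C C, D (Tens.contractRight ξ.toLin x) =
      Tens.contractRight ξ.toLin (Tens.map D.right LinearMap.id x) := fun x =>
    DFunLike.congr_fun (Tens.hom_ext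
      (f := D.toAddMonoidHom.comp (Tens.contractRight ξ.toLin))
      (g := (Tens.contractRight ξ.toLin).comp (Tens.map D.right LinearMap.id))
      fun m n => D.map_smul_right _ _) x
  have h3 : ∀ x : Tens A (Tens A C C) C,
      Tens.map LinearMap.id (contractRightLin ξ.toLin) (Tens.assoc A C C C x) =
        Tens.contractRight ξ.toLin x := fun x =>
    DFunLike.congr_fun (Tens.hom_ext
      (f := (Tens.map LinearMap.id (contractRightLin ξ.toLin)).comp
        (Tens.assoc A C C C).toAddMonoidHom)
      (g := Tens.contractRight ξ.toLin) fun y n => by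
        induction y using Tens.induction_on with
        | h0 => rw [Tens.zero_tmul, map_zero, map_zero]
        | ht c c' => rfl
        | ha x y hx hy => rw [Tens.add_tmul, map_add, map_add, hx, hy]) x
  rw [h1, h2, ← Coring.coassoc, h3]

theorem RightDual.mul_assoc' (ξ η ζ : RightDual A C) :
    RightDual.mul (RightDual.mul ξ η) ζ = RightDual.mul ξ (RightDual.mul η ζ) := by
  apply RightDual.ext
  intro c
  rw [mul_def, mul_def, mul_def]
  congr 1
  let D := Coring.comul (A := A) (C := C)
  have h1 : ∀ x : Tens A C C, Tens.contractLeft (M := C) (RightDual.mul η ζ).toLin x =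
      Tens.contractLeft η.toLin (Tens.map (contractLeftLin ζ.toLin) LinearMap.id
        (Tens.map D.right LinearMap.id x)) := fun x =>
    DFunLike.congr_fun (Tens.hom_ext
      (f := Tens.contractLeft (M := C) (RightDual.mul η ζ).toLin)
      (g := (Tens.contractLeft η.toLin).comp
        ((Tens.map (contractLeftLin ζ.toLin) LinearMap.id).comp
          (Tens.map D.right LinearMap.id))) fun _ _ => rfl) x
  have h2 : ∀ x : Tens A C C, D (Tens.contractLeft ζ.toLin x) =
      Tens.contractLeft ζ.toLin (Tens.map LinearMap.id D.left x) := fun x =>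
    DFunLike.congr_fun (Tens.hom_ext
      (f := D.toAddMonoidHom.comp (Tens.contractLeft ζ.toLin))
      (g := (Tens.contractLeft ζ.toLin).comp (Tens.map LinearMap.id D.left))
      fun m n => D.map_smul_left _ _) x
  have h3 : ∀ x : Tens A (Tens A C C) C,
      Tens.contractLeft ζ.toLin (Tens.assoc A C C C x) =
        Tens.map (contractLeftLin ζ.toLin) LinearMap.id x := fun x =>
    DFunLike.congr_fun (Tens.hom_ext
      (f := (Tens.contractLeft ζ.toLin).comp (Tens.assoc A C C C).toAddMonoidHom)
      (g := Tens.map (contractLeftLin ζ.toLin) LinearMap.id) fun y n => by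
        induction y using Tens.induction_on with
        | h0 => rw [Tens.zero_tmul, map_zero, map_zero]
        | ht c c' => rfl
        | ha x y hx hy => rw [Tens.add_tmul, map_add, map_add, hx, hy]) x
  rw [h1, h2, ← Coring.coassoc, h3]

/-- The ring `*C`, with unit the counit of `C`. -/
instance LeftDual.ring : Ring (LeftDual A C) where
  __ := (inferInstance : AddCommGroup (LeftDual A C))
  mul := LeftDual.mul
  one := (Coring.counit (A := A) (C := C)).left
  mul_assoc := LeftDual.mul_assoc'
  one_mul ξ := by
    apply LeftDual.ext
    intro c
    exact congrArg ξ.toLin (Coring.comul_counit (A := A) c)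
  mul_one ξ := by
    apply LeftDual.ext
    intro c
    let e := Coring.counit (A := A) (C := C)
    have h : ∀ x : Tens A C C, e (Tens.contractRight ξ.toLin x) =
        ξ.toLin (Tens.contractLeft e.right x) := fun x =>
      DFunLike.congr_fun (Tens.hom_ext
        (f := e.toAddMonoidHom.comp (Tens.contractRight ξ.toLin))
        (g := ξ.toLin.toAddMonoidHom.comp (Tens.contractLeft e.right))
        fun m n => (e.map_smul_right _ _).trans (ξ.toLin.map_smul (e m) n).symm) x
    exact (h _).trans (congrArg ξ.toLin (Coring.counit_comul (A := A) c))
  zero_mul ξ := by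
    apply LeftDual.ext
    intro c
    have h : Tens.contractRight (M := C) (0 : C →ₗ[A] A) = 0 :=
      Tens.hom_ext fun m n => by simp
    exact (congrArg ξ.toLin (DFunLike.congr_fun h _)).trans (map_zero ξ.toLin)
  mul_zero ξ := rfl
  left_distrib ξ η ζ := rfl
  right_distrib ξ η ζ := by
    apply LeftDual.ext
    intro c
    have h : Tens.contractRight (M := C) (ξ.toLin + η.toLin) =
        Tens.contractRight ξ.toLin + Tens.contractRight η.toLin :=
      Tens.hom_ext fun m n => by simp [add_smul]
    exact (congrArg ζ.toLin (DFunLike.congr_fun h _)).trans (map_add ζ.toLin _ _)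

/-- The ring `C*`, with unit the counit of `C`. -/
instance RightDual.ring : Ring (RightDual A C) where
  __ := (inferInstance : AddCommGroup (RightDual A C))
  mul := RightDual.mul
  one := (Coring.counit (A := A) (C := C)).right
  mul_assoc := RightDual.mul_assoc'
  mul_one ξ := by
    apply RightDual.ext
    intro c
    exact congrArg ξ.toLin (Coring.counit_comul (A := A) c)
  one_mul ξ := by
    apply RightDual.ext
    intro c
    let e := Coring.counit (A := A) (C := C)
    have h : ∀ x : Tens A C C, e (Tens.contractLeft ξ.toLin x) =
        ξ.toLin (Tens.contractRight e.left x) := fun x =>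
      DFunLike.congr_fun (Tens.hom_ext
        (f := e.toAddMonoidHom.comp (Tens.contractLeft ξ.toLin))
        (g := ξ.toLin.toAddMonoidHom.comp (Tens.contractRight e.left))
        fun m n => (e.map_smul_left _ _).trans (ξ.toLin.map_smul (op (e n)) m).symm) x
    exact (h _).trans (congrArg ξ.toLin (Coring.comul_counit (A := A) c))
  mul_zero ξ := by
    apply RightDual.ext
    intro c
    have h : Tens.contractLeft (M := C) (0 : C →ₗ[Aᵐᵒᵖ] A) = 0 :=
      Tens.hom_ext fun m n => by simp
    exact (congrArg ξ.toLin (DFunLike.congr_fun h _)).trans (map_zero ξ.toLin)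
  zero_mul ξ := rfl
  right_distrib ξ η ζ := rfl
  left_distrib ζ ξ η := by
    apply RightDual.ext
    intro c
    have h : Tens.contractLeft (M := C) (ξ.toLin + η.toLin) =
        Tens.contractLeft ξ.toLin + Tens.contractLeft η.toLin :=
      Tens.hom_ext fun m n => by simp [add_smul]
    exact (congrArg ζ.toLin (DFunLike.congr_fun h _)).trans (map_add ζ.toLin _ _)

theorem LeftDual.mul_toLin (ξ ξ' : LeftDual A C) (c : C) :
    (ξ * ξ').toLin c = ξ'.toLin (Tens.contractRight ξ.toLin (Coring.comul (A := A) c)) := rfl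

theorem RightDual.mul_toLin (ξ ξ' : RightDual A C) (c : C) :
    (ξ * ξ').toLin c = ξ.toLin (Tens.contractLeft ξ'.toLin (Coring.comul (A := A) c)) := rfl

variable (A C)

/-- `c ↦ ε(c a)` -/
def LeftDual.unitFun (a : A) : C →ₗ[A] A where
  toFun c := Coring.counit (A := A) (op a • c)
  map_add' c c' := by rw [smul_add, map_add]
  map_smul' b c := by rw [← smul_comm]; exact BimodHom.map_smul_left _ _ _

/-- `c ↦ ε(a c)` -/
def RightDual.unitFun (a : A) : C →ₗ[Aᵐᵒᵖ] A where
  toFun c := Coring.counit (A := A) (a • c)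
  map_add' c c' := by rw [smul_add, map_add]
  map_smul' b c := by rw [smul_comm]; exact BimodHom.map_smul_right _ b.unop _

/-- The ring map `*ι : A → *C`, `a ↦ (c ↦ ε(c a))`. -/
def LeftDual.unitHom : A →+* LeftDual A C where
  toFun a := LeftDual.unitFun A C a
  map_one' := LeftDual.ext fun c =>
    congrArg (Coring.counit (A := A) (C := C)) (one_smul Aᵐᵒᵖ c)
  map_zero' := LeftDual.ext fun c =>
    (congrArg (Coring.counit (A := A) (C := C)) (zero_smul Aᵐᵒᵖ c)).trans (map_zero _)
  map_add' a b := LeftDual.ext fun c =>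
    (congrArg (Coring.counit (A := A) (C := C)) (add_smul (op a) (op b) c)).trans
      (map_add _ _ _)
  map_mul' a b := LeftDual.ext fun c => by
    have h : ∀ x : Tens A C C,
        Tens.contractRight (Coring.counit (A := A) (C := C)).left (op a • x) =
          Tens.contractRight (LeftDual.unitFun A C a) x := fun x => by
      induction x using Tens.induction_on with
      | h0 => rw [smul_zero, map_zero, map_zero]
      | ht c c' => rfl
      | ha x y hx hy => rw [smul_add, map_add, map_add, hx, hy]
    have h' : op a • c =
        Tens.contractRight (LeftDual.unitFun A C a) (Coring.comul (A := A) c) := by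
      rw [← h, ← BimodHom.map_smul_right, Coring.comul_counit]
    change Coring.counit (A := A) ((op b * op a) • c) = Coring.counit (A := A)
      (op b • Tens.contractRight (LeftDual.unitFun A C a) (Coring.comul (A := A) c))
    rw [← h', mul_smul]

/-- The ring map `ι* : A → C*`, `a ↦ (c ↦ ε(a c))`. -/
def RightDual.unitHom : A →+* RightDual A C where
  toFun a := RightDual.unitFun A C a
  map_one' := RightDual.ext fun c =>
    congrArg (Coring.counit (A := A) (C := C)) (one_smul A c)
  map_zero' := RightDual.ext fun c =>
    (congrArg (Coring.counit (A := A) (C := C)) (zero_smul A c)).trans (map_zero _)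
  map_add' a b := RightDual.ext fun c =>
    (congrArg (Coring.counit (A := A) (C := C)) (add_smul a b c)).trans (map_add _ _ _)
  map_mul' a b := RightDual.ext fun c => by
    have h : ∀ x : Tens A C C,
        Tens.contractLeft (Coring.counit (A := A) (C := C)).right (b • x) =
          Tens.contractLeft (RightDual.unitFun A C b) x := fun x => by
      induction x using Tens.induction_on with
      | h0 => rw [smul_zero, map_zero, map_zero]
      | ht c c' => rfl
      | ha x y hx hy => rw [smul_add, map_add, map_add, hx, hy]
    have h' : b • c =
        Tens.contractLeft (RightDual.unitFun A C b) (Coring.comul (A := A) c) := by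
      rw [← h, ← BimodHom.map_smul_left, Coring.counit_comul]
    change Coring.counit (A := A) ((a * b) • c) = Coring.counit (A := A)
      (a • Tens.contractLeft (RightDual.unitFun A C b) (Coring.comul (A := A) c))
    rw [← h', mul_smul]

end Duals

/-! ### Separable extensions -/

section Separable

/-- The ring `B`, regarded as an `(A, A)`-bimodule through a ring map `ι : A → B`. -/
def ExtRing {A B : Type*} [Ring A] [Ring B] (_ : A →+* B) : Type _ := B

variable {A B : Type*} [Ring A] [Ring B] (ι : A →+* B)

instance : Ring (ExtRing ι) := inferInstanceAs (Ring B)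

/-- `ι` as a map into `ExtRing ι`. -/
def ExtRing.incl : A →+* ExtRing ι := ι

/-- `a b = ι(a) b` -/
instance ExtRing.moduleLeft : Module A (ExtRing ι) :=
  Module.compHom (ExtRing ι) (ExtRing.incl ι)

/-- `b a = b ι(a)` -/
instance ExtRing.moduleRight : Module Aᵐᵒᵖ (ExtRing ι) :=
  Module.compHom (ExtRing ι) (ExtRing.incl ι).op

theorem ExtRing.left_smul_def (a : A) (b : ExtRing ι) : a • b = ExtRing.incl ι a * b := rfl

theorem ExtRing.right_smul_def (a : A) (b : ExtRing ι) : op a • b = b * ExtRing.incl ι a := rfl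

/-- `ExtRing ι` is a `(B, A)`-bimodule. -/
instance : SMulCommClass (ExtRing ι) Aᵐᵒᵖ (ExtRing ι) :=
  ⟨fun b a c => (mul_assoc b c (ExtRing.incl ι a.unop)).symm⟩

/-- `ExtRing ι` is an `(A, B)`-bimodule. -/
instance : SMulCommClass A (ExtRing ι)ᵐᵒᵖ (ExtRing ι) :=
  ⟨fun a b c => (mul_assoc (ExtRing.incl ι a) c b.unop).symm⟩

/-- The multiplication map `B ⊗_A B → B`. -/
def ExtRing.mulMap : Tens A (ExtRing ι) (ExtRing ι) →+ ExtRing ι :=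
  Tens.lift AddMonoidHom.mul fun b a c => mul_assoc b (ExtRing.incl ι a) c

theorem ExtRing.mulMap_tmul (b c : ExtRing ι) :
    ExtRing.mulMap ι (Tens.tmul A b c) = b * c := rfl

/-- `ι : A → B` is a separable extension: the multiplication map `B ⊗_A B → B` has a
section which is a map of `(B, B)`-bimodules. -/
def IsSeparableExtension : Prop :=
  ∃ δ : BimodHom (ExtRing ι) (ExtRing ι) (ExtRing ι) (Tens A (ExtRing ι) (ExtRing ι)),
    ∀ b : ExtRing ι, ExtRing.mulMap ι (δ b) = b

end Separable

end Corings

end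

noncomputable section

namespace Corings

open scoped TensorProduct
open MulOpposite

/-! Both conditions are shown to describe the same functional on `C ⊗_A C`. On the coring side, a
bicomodule retraction `π` of `Δ` is determined by `γ = ε ∘ π`: the counit laws recover `π(c ⊗ c')`
both as `∑ c₁ γ(c₂ ⊗ c')` and as `∑ γ(c ⊗ c'₁) c'₂`. So coseparability amounts to a bimodule map `γ`
with `γ ∘ Δ = ε` for which these two expressions agree, a cointegral
(`isCoseparable_iff_exists_isCointegral`). On the ring side, a bimodule section of `B ⊗_A B → B` is
determined by its value `x` at `1`, which satisfies `b x = x b` and multiplies to `1`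
(`isSeparableExtension_iff`).

For `B = *C` the bridge sends `ξ ⊗ ξ'` to the left linear functional `c ⊗ c' ↦ ξ'(c ξ(c'))`. It is
bijective when `C` is finitely generated projective on the left (`LeftDual.pairing_bijective`). If
`x` corresponds to `F`, its product is `F ∘ Δ`, so the normalisations match. The condition `b x = x
b` reads `∑ F(c ⊗ c'₁ b(c'₂)) = b(∑ c₁ F(c₂ ⊗ c'))`. When `F` is right linear the left side is `b(∑
F(c ⊗ c'₁) c'₂)`, so the balance of a cointegral gives `b x = x b`. Conversely, `b = *ι(a)` yields
the right linearity of `F`, and functionals separating the points of `C` yield balance. The case of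
`C*` is the mirror image. -/

/-- A finitely generated projective module has a finite dual basis. -/
theorem exists_finite_dual_basis (R M : Type*) [Ring R] [AddCommGroup M] [Module R M]
    [Module.Finite R M] [Module.Projective R M] :
    ∃ (n : ℕ) (e : Fin n → M) (f : Fin n → M →ₗ[R] R), ∀ m, ∑ i, f i m • e i = m := by
  obtain ⟨n, p, hp⟩ := Module.Finite.exists_fin' R M
  obtain ⟨s, hs⟩ := Module.projective_lifting_property p LinearMap.id hp
  -- The generators are the images of the standard basis of `Fin n → R`; the functionals are the
  -- coordinates of the splitting `s`.
  refine ⟨n, fun i => p (Pi.single i 1), fun i => LinearMap.proj i ∘ₗ s, fun m => ?_⟩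
  have h : ∑ i, s m i • (Pi.single i 1 : Fin n → R) = s m := by
    ext j
    simp [Finset.sum_apply, Pi.single_apply]
  calc ∑ i, s m i • p (Pi.single i 1) = p (s m) := by
        rw [← h, map_sum]
        simp only [map_smul, h]
    _ = m := DFunLike.congr_fun hs m

/-- The dual basis of a finitely generated projective right module. -/
theorem exists_finite_right_dual_basis (A M : Type*) [Ring A] [AddCommGroup M]
    [Module Aᵐᵒᵖ M] [Module.Finite Aᵐᵒᵖ M] [Module.Projective Aᵐᵒᵖ M] :
    ∃ (n : ℕ) (e : Fin n → M) (f : Fin n → M →ₗ[Aᵐᵒᵖ] A), ∀ m, ∑ i, op (f i m) • e i = m := by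
  obtain ⟨n, e, f, h⟩ := exists_finite_dual_basis Aᵐᵒᵖ M
  exact ⟨n, e, fun i =>
    { toFun := fun m => unop (f i m)
      map_add' := fun m m' => by rw [map_add, unop_add]
      map_smul' := fun a m => by rw [map_smul]; rfl }, h⟩

/-! ### Separability elements -/

section Separable

variable {A B : Type*} [Ring A] [Ring B] (ι : A →+* B)

theorem ExtRing.mulMap_left_smul (b : ExtRing ι) (x : Tens A (ExtRing ι) (ExtRing ι)) :
    ExtRing.mulMap ι (b • x) = b * ExtRing.mulMap ι x := by
  induction x using Tens.induction_on with
  | h0 => rw [smul_zero, map_zero, mul_zero]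
  | ht c d => exact mul_assoc b c d
  | ha x y hx hy => rw [smul_add, map_add, map_add, mul_add, hx, hy]

/-- Separability in terms of a Casimir element. -/
theorem isSeparableExtension_iff : IsSeparableExtension ι ↔
    ∃ x : Tens A (ExtRing ι) (ExtRing ι), ExtRing.mulMap ι x = 1 ∧
      ∀ b : ExtRing ι, b • x = op b • x := by
  constructor
  · rintro ⟨δ, hδ⟩
    refine ⟨δ 1, hδ 1, fun b => ?_⟩
    rw [← δ.map_smul_left, ← δ.map_smul_right]
    congr 1
    exact (mul_one b).trans (one_mul b).symm
  · rintro ⟨x, hx, hc⟩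
    refine ⟨{ toFun := fun b => b • x
              map_zero' := zero_smul _ x
              map_add' := fun b c => add_smul b c x
              map_left_smul := fun b c => mul_smul b c x
              -- The map `b ↦ b x` is always left linear; its right linearity is the Casimir
              -- identity: `(c b) x = c (b x) = c (x b)`.
              map_right_smul := fun b c => ?_ }, fun b => ?_⟩
    · change (c * b) • x = op b • c • x
      rw [mul_smul, hc b]
      exact smul_comm c (op b) x
    · change ExtRing.mulMap ι (b • x) = b
      rw [ExtRing.mulMap_left_smul, hx, mul_one]

end Separable

/-! ### Cointegrals -/

section Cointegral

variable {A : Type*} {C : Type*} [Ring A] [AddCommGroup C] [Module A C] [Module Aᵐᵒᵖ C]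
  [SMulCommClass A Aᵐᵒᵖ C]

/-- `c ↦ F (c ⊗ c')` -/
def sliceLeft (F : Tens A C C →ₗ[A] A) (c' : C) : C →ₗ[A] A where
  toFun c := F (Tens.tmul A c c')
  map_add' c d := by rw [Tens.add_tmul, map_add]
  map_smul' a c := F.map_smul a (Tens.tmul A c c')

/-- `c' ↦ F (c ⊗ c')` -/
def sliceRight (F : Tens A C C →ₗ[Aᵐᵒᵖ] A) (c : C) : C →ₗ[Aᵐᵒᵖ] A where
  toFun c' := F (Tens.tmul A c c')
  map_add' c d := by rw [Tens.tmul_add, map_add]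
  map_smul' a c' := F.map_smul a (Tens.tmul A c c')

@[simp] theorem sliceLeft_apply (F : Tens A C C →ₗ[A] A) (c c' : C) :
    sliceLeft F c' c = F (Tens.tmul A c c') := rfl

@[simp] theorem sliceRight_apply (F : Tens A C C →ₗ[Aᵐᵒᵖ] A) (c c' : C) :
    sliceRight F c c' = F (Tens.tmul A c c') := rfl

/-! ### Naturality of contractions and their compatibility with associativity -/

/-- A linear map commutes with contraction on the right. -/
theorem map_contractRight {M N P : Type*} [AddCommGroup M] [AddCommGroup N] [AddCommGroup P]
    [Module Aᵐᵒᵖ M] [Module Aᵐᵒᵖ N] [Module A P] (f : M →ₗ[Aᵐᵒᵖ] N) (ξ : P →ₗ[A] A)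
    (x : Tens A M P) :
    f (Tens.contractRight ξ x) = Tens.contractRight ξ (Tens.map f LinearMap.id x) :=
  DFunLike.congr_fun (Tens.hom_ext
    (f := f.toAddMonoidHom.comp (Tens.contractRight ξ))
    (g := (Tens.contractRight ξ).comp (Tens.map f LinearMap.id))
    fun _ _ => f.map_smul _ _) x

/-- A linear map commutes with contraction on the left. -/
theorem map_contractLeft {M N P : Type*} [AddCommGroup M] [AddCommGroup N] [AddCommGroup P]
    [Module A M] [Module A N] [Module Aᵐᵒᵖ P] (f : M →ₗ[A] N) (ξ : P →ₗ[Aᵐᵒᵖ] A)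
    (x : Tens A P M) :
    f (Tens.contractLeft ξ x) = Tens.contractLeft ξ (Tens.map LinearMap.id f x) :=
  DFunLike.congr_fun (Tens.hom_ext
    (f := f.toAddMonoidHom.comp (Tens.contractLeft ξ))
    (g := (Tens.contractLeft ξ).comp (Tens.map LinearMap.id f))
    fun _ _ => f.map_smul _ _) x

theorem contractRight_map {M N P : Type*} [AddCommGroup M] [AddCommGroup N] [AddCommGroup P]
    [Module Aᵐᵒᵖ M] [Module A N] [Module A P] (f : N →ₗ[A] P) (ξ : P →ₗ[A] A)
    (x : Tens A M N) :
    Tens.contractRight ξ (Tens.map LinearMap.id f x) = Tens.contractRight (ξ ∘ₗ f) x :=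
  DFunLike.congr_fun (Tens.hom_ext
    (f := (Tens.contractRight ξ).comp (Tens.map LinearMap.id f))
    (g := Tens.contractRight (M := M) (ξ ∘ₗ f)) fun _ _ => rfl) x

theorem contractLeft_map {M N P : Type*} [AddCommGroup M] [AddCommGroup N] [AddCommGroup P]
    [Module A M] [Module Aᵐᵒᵖ N] [Module Aᵐᵒᵖ P] (f : N →ₗ[Aᵐᵒᵖ] P) (ξ : P →ₗ[Aᵐᵒᵖ] A)
    (x : Tens A N M) :
    Tens.contractLeft ξ (Tens.map f LinearMap.id x) = Tens.contractLeft (ξ ∘ₗ f) x :=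
  DFunLike.congr_fun (Tens.hom_ext
    (f := (Tens.contractLeft ξ).comp (Tens.map f LinearMap.id))
    (g := Tens.contractLeft (M := M) (ξ ∘ₗ f)) fun _ _ => rfl) x

/-- `d ⊗ d' ↦ d ⊗ (d' ⊗ c)` followed by contraction. -/
theorem contractRight_assoc_tmul (F : Tens A C C →ₗ[A] A) (y : Tens A C C) (c : C) :
    Tens.contractRight F (Tens.assoc A C C C (Tens.tmul A y c)) =
      Tens.contractRight (sliceLeft F c) y := by
  induction y using Tens.induction_on with
  | h0 => rw [Tens.zero_tmul, map_zero, map_zero, map_zero]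
  | ht d d' => rfl
  | ha x y hx hy => rw [Tens.add_tmul, map_add, map_add, map_add, hx, hy]

theorem contractLeft_assoc_symm_tmul (F : Tens A C C →ₗ[Aᵐᵒᵖ] A) (y : Tens A C C) (c : C) :
    Tens.contractLeft F ((Tens.assoc A C C C).symm (Tens.tmul A c y)) =
      Tens.contractLeft (sliceRight F c) y := by
  induction y using Tens.induction_on with
  | h0 => rw [Tens.tmul_zero, map_zero, map_zero, map_zero]
  | ht d d' => rfl
  | ha x y hx hy => rw [Tens.tmul_add, map_add, map_add, map_add, hx, hy]

/-- Contracting the last of three factors does not depend on the bracketing. This lets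
coassociativity be applied under a contraction. -/
theorem map_contractRightLin_assoc (ξ : C →ₗ[A] A) (x : Tens A (Tens A C C) C) :
    Tens.map LinearMap.id (contractRightLin ξ) (Tens.assoc A C C C x) =
      Tens.contractRight ξ x :=
  DFunLike.congr_fun (Tens.hom_ext
    (f := (Tens.map LinearMap.id (contractRightLin ξ)).comp
      (Tens.assoc A C C C).toAddMonoidHom)
    (g := Tens.contractRight ξ) fun y n => by
      induction y using Tens.induction_on with
      | h0 => rw [Tens.zero_tmul, map_zero, map_zero]
      | ht c c' => rfl
      | ha x y hx hy => rw [Tens.add_tmul, map_add, map_add, hx, hy]) x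

theorem contractLeft_assoc (ξ : C →ₗ[Aᵐᵒᵖ] A) (x : Tens A (Tens A C C) C) :
    Tens.contractLeft ξ (Tens.assoc A C C C x) =
      Tens.map (contractLeftLin ξ) LinearMap.id x :=
  DFunLike.congr_fun (Tens.hom_ext
    (f := (Tens.contractLeft ξ).comp (Tens.assoc A C C C).toAddMonoidHom)
    (g := Tens.map (contractLeftLin ξ) LinearMap.id) fun y n => by
      induction y using Tens.induction_on with
      | h0 => rw [Tens.zero_tmul, map_zero, map_zero]
      | ht c c' => rfl
      | ha x y hx hy => rw [Tens.add_tmul, map_add, map_add, hx, hy]) x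

variable [Coring A C]

/-- `Δ(∑ c₁ ξ(c₂)) = ∑ c₁ ⊗ c₂ ξ(c₃)` -/
theorem comul_contractRight_comul (ξ : C →ₗ[A] A) (c : C) :
    Coring.comul (A := A) (Tens.contractRight ξ (Coring.comul (A := A) c)) =
      Tens.map LinearMap.id (contractRightLin ξ ∘ₗ (Coring.comul (A := A) (C := C)).left)
        (Coring.comul (A := A) c) := by
  have h := map_contractRight (Coring.comul (A := A) (C := C)).right ξ (Coring.comul (A := A) c)
  rw [BimodHom.right_apply] at h
  -- Right linearity of `Δ` applies it to the first factor, and coassociativity moves it to the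
  -- second, next to `ξ`.
  rw [h, ← map_contractRightLin_assoc, Coring.coassoc, Tens.map_map]
  rfl

/-- `Δ(∑ ξ(c₁) c₂) = ∑ ξ(c₁) c₂ ⊗ c₃` -/
theorem comul_contractLeft_comul (ξ : C →ₗ[Aᵐᵒᵖ] A) (c : C) :
    Coring.comul (A := A) (Tens.contractLeft ξ (Coring.comul (A := A) c)) =
      Tens.map (contractLeftLin ξ ∘ₗ (Coring.comul (A := A) (C := C)).right) LinearMap.id
        (Coring.comul (A := A) c) := by
  have h := map_contractLeft (Coring.comul (A := A) (C := C)).left ξ (Coring.comul (A := A) c)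
  rw [BimodHom.left_apply] at h
  rw [h, ← Coring.coassoc, contractLeft_assoc, Tens.map_map]
  rfl

/-- A cointegral: `γ ∘ Δ = ε` and `∑ c₁ γ(c₂ ⊗ c') = ∑ γ(c ⊗ c'₁) c'₂`. -/
structure IsCointegral (γ : BimodHom A A (Tens A C C) A) : Prop where
  apply_comul : ∀ c : C, γ (Coring.comul (A := A) c) = Coring.counit (A := A) c
  balance : ∀ c c' : C,
    Tens.contractRight (sliceLeft γ.left c') (Coring.comul (A := A) c) =
      Tens.contractLeft (sliceRight γ.right c) (Coring.comul (A := A) c')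

-- Take `γ = ε ∘ π`. Left colinearity followed by `ε` on the last factor, and right colinearity
-- followed by `ε` on the first, give two formulas for `π(c ⊗ c')`. Balance is their equality.
variable (A C) in
theorem IsCoseparable.exists_isCointegral (h : IsCoseparable A C) :
    ∃ γ : BimodHom A A (Tens A C C) A, IsCointegral γ := by
  obtain ⟨π, hl, hr, hs⟩ := h
  let e := Coring.counit (A := A) (C := C)
  let γ : BimodHom A A (Tens A C C) A :=
    { toFun := fun x => e (π x)
      map_zero' := by rw [map_zero, map_zero]
      map_add' := fun x y => by rw [map_add, map_add]
      map_left_smul := fun a x => by rw [π.map_smul_left, e.map_smul_left]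
      map_right_smul := fun a x => by rw [π.map_smul_right, e.map_smul_right] }
  refine ⟨γ, fun c => congrArg e (hs c), fun c c' => ?_⟩
  have h1 : Tens.contractRight (sliceLeft γ.left c') (Coring.comul (A := A) c) =
      π (Tens.tmul A c c') := by
    rw [← contractRight_assoc_tmul]
    have h := congrArg (Tens.contractRight e.left) (hl (Tens.tmul A c c'))
    rw [contractRight_map] at h
    exact h.symm.trans (Coring.comul_counit (A := A) (π (Tens.tmul A c c')))
  have h2 : Tens.contractLeft (sliceRight γ.right c) (Coring.comul (A := A) c') =
      π (Tens.tmul A c c') := by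
    rw [← contractLeft_assoc_symm_tmul]
    have h := congrArg (Tens.contractLeft e.right) (hr (Tens.tmul A c c'))
    rw [contractLeft_map] at h
    exact h.symm.trans (Coring.counit_comul (A := A) (π (Tens.tmul A c c')))
  rw [h1, h2]

/-- `c ⊗ c' ↦ ∑ c₁ γ(c₂ ⊗ c')` -/
def cointegralSplitting (γ : BimodHom A A (Tens A C C) A) : BimodHom A A (Tens A C C) C :=
  let φ : Tens A C C →+ C := (Tens.contractRight γ.left).comp (tensLeftCoaction A C)
  have hφ (c c' : C) : φ (Tens.tmul A c c') =
      Tens.contractRight (sliceLeft γ.left c') (Coring.comul (A := A) c) :=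
    contractRight_assoc_tmul _ _ _
  { φ with
    map_left_smul := fun a x => by
      change φ (a • x) = a • φ x
      induction x using Tens.induction_on with
      | h0 => rw [smul_zero, map_zero, smul_zero]
      | ht c c' =>
        rw [Tens.left_smul_tmul, hφ, hφ, BimodHom.map_smul_left]
        exact (contractRightLin _).map_smul a _
      | ha x y hx hy => rw [smul_add, map_add, map_add, smul_add, hx, hy]
    map_right_smul := fun a x => by
      change φ (op a • x) = op a • φ x
      induction x using Tens.induction_on with
      | h0 => rw [smul_zero, map_zero, smul_zero]
      | ht c c' =>
        rw [Tens.right_smul_tmul, hφ, hφ]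
        generalize Coring.comul (A := A) c = y
        induction y using Tens.induction_on with
        | h0 => rw [map_zero, map_zero, smul_zero]
        | ht d d' =>
          rw [Tens.contractRight_tmul, Tens.contractRight_tmul, ← mul_smul]
          congr 1
          exact congrArg op (γ.map_smul_right a (Tens.tmul A d' c'))
        | ha x y hx hy => rw [map_add, map_add, smul_add, hx, hy]
      | ha x y hx hy => rw [smul_add, map_add, map_add, smul_add, hx, hy] }

theorem cointegralSplitting_tmul (γ : BimodHom A A (Tens A C C) A) (c c' : C) :
    cointegralSplitting γ (Tens.tmul A c c') =
      Tens.contractRight (sliceLeft γ.left c') (Coring.comul (A := A) c) :=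
  contractRight_assoc_tmul _ _ _

/-- Balance supplies the mirror formula for the splitting, the one suited to the right coaction. -/
theorem IsCointegral.cointegralSplitting_tmul' {γ : BimodHom A A (Tens A C C) A}
    (hγ : IsCointegral γ) (c c' : C) : cointegralSplitting γ (Tens.tmul A c c') =
      Tens.contractLeft (sliceRight γ.right c) (Coring.comul (A := A) c') :=
  (cointegralSplitting_tmul γ c c').trans (hγ.balance c c')

/-- Coassociativity alone suffices here: the splitting acts on the right of `c₁`, and balance plays
no role. -/
theorem isLeftColinear_cointegralSplitting (γ : BimodHom A A (Tens A C C) A) :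
    IsLeftColinear (tensLeftCoaction A C) (Coring.comul (A := A) (C := C)).toAddMonoidHom
      (cointegralSplitting γ).left := fun x => by
  refine DFunLike.congr_fun (Tens.hom_ext
    (f := (Coring.comul (A := A) (C := C)).toAddMonoidHom.comp
      (cointegralSplitting γ).toAddMonoidHom)
    (g := (Tens.map LinearMap.id (cointegralSplitting γ).left).comp (tensLeftCoaction A C))
    fun c c' => ?_) x
  change Coring.comul (A := A) (cointegralSplitting γ (Tens.tmul A c c')) =
    Tens.map LinearMap.id (cointegralSplitting γ).left
      (Tens.assoc A C C C (Tens.tmul A (Coring.comul (A := A) c) c'))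
  rw [cointegralSplitting_tmul, comul_contractRight_comul]
  generalize Coring.comul (A := A) c = y
  induction y using Tens.induction_on with
  | h0 => rw [Tens.zero_tmul, map_zero, map_zero, map_zero]
  | ht d d' => exact congrArg (Tens.tmul A d) (cointegralSplitting_tmul γ d' c').symm
  | ha x y hx hy => rw [Tens.add_tmul, map_add, map_add, map_add, hx, hy]

theorem IsCointegral.isRightColinear {γ : BimodHom A A (Tens A C C) A} (hγ : IsCointegral γ) :
    IsRightColinear (tensRightCoaction A C) (Coring.comul (A := A) (C := C)).toAddMonoidHom
      (cointegralSplitting γ).right := fun x => by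
  refine DFunLike.congr_fun (Tens.hom_ext
    (f := (Coring.comul (A := A) (C := C)).toAddMonoidHom.comp
      (cointegralSplitting γ).toAddMonoidHom)
    (g := (Tens.map (cointegralSplitting γ).right LinearMap.id).comp (tensRightCoaction A C))
    fun c c' => ?_) x
  change Coring.comul (A := A) (cointegralSplitting γ (Tens.tmul A c c')) =
    Tens.map (cointegralSplitting γ).right LinearMap.id
      ((Tens.assoc A C C C).symm (Tens.tmul A c (Coring.comul (A := A) c')))
  rw [hγ.cointegralSplitting_tmul', comul_contractLeft_comul]
  generalize Coring.comul (A := A) c' = y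
  induction y using Tens.induction_on with
  | h0 => rw [Tens.tmul_zero, map_zero, map_zero, map_zero]
  | ht d d' =>
    exact congrArg (fun z => Tens.tmul A z d') (hγ.cointegralSplitting_tmul' c d).symm
  | ha x y hx hy => rw [Tens.tmul_add, map_add, map_add, map_add, hx, hy]

/-- By coassociativity the composite with `Δ` is `∑ c₁ γ(Δ c₂) = ∑ c₁ ε(c₂) = c`. -/
theorem IsCointegral.cointegralSplitting_comul {γ : BimodHom A A (Tens A C C) A}
    (hγ : IsCointegral γ) (c : C) :
    cointegralSplitting γ (Coring.comul (A := A) c) = c := by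
  change Tens.contractRight γ.left (Tens.assoc A C C C
    (Tens.map (Coring.comul (A := A) (C := C)).right LinearMap.id (Coring.comul (A := A) c))) = c
  rw [Coring.coassoc, contractRight_map]
  have h : γ.left ∘ₗ (Coring.comul (A := A) (C := C)).left =
      (Coring.counit (A := A) (C := C)).left := LinearMap.ext hγ.apply_comul
  rw [h, Coring.comul_counit]

variable (A C) in
/-- A coring is coseparable exactly when it has a cointegral. -/
theorem isCoseparable_iff_exists_isCointegral :
    IsCoseparable A C ↔ ∃ γ : BimodHom A A (Tens A C C) A, IsCointegral γ :=
  ⟨IsCoseparable.exists_isCointegral A C, fun ⟨γ, hγ⟩ => ⟨cointegralSplitting γ,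
    isLeftColinear_cointegralSplitting γ, hγ.isRightColinear, hγ.cointegralSplitting_comul⟩⟩

end Cointegral

/-! ### Tensor squares of the dual rings as functionals on the tensor square of the coring -/

section Pairing

variable {A : Type*} {C : Type*} [Ring A] [AddCommGroup C] [Module A C] [Module Aᵐᵒᵖ C]
  [SMulCommClass A Aᵐᵒᵖ C] [Coring A C]

/-! ### The left dual -/

/-- This is the unit law `ξ ε = ξ`, evaluated at `c`. -/
theorem LeftDual.counit_contractRight (ξ : LeftDual A C) (c : C) :
    Coring.counit (A := A) (Tens.contractRight ξ.toLin (Coring.comul (A := A) c)) =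
      ξ.toLin c :=
  congrArg (fun η : LeftDual A C => η.toLin c) (mul_one ξ)

/-- Right linearity of `Δ` turns `∑ c₁ ε(c₂ a)` into the counit law for `c a`. -/
theorem LeftDual.contractRight_unitFun (a : A) (c : C) :
    Tens.contractRight (LeftDual.unitFun A C a) (Coring.comul (A := A) c) = op a • c := by
  have h : ∀ x : Tens A C C,
      Tens.contractRight (Coring.counit (A := A) (C := C)).left (op a • x) =
        Tens.contractRight (LeftDual.unitFun A C a) x := fun x => by
    induction x using Tens.induction_on with
    | h0 => rw [smul_zero, map_zero, map_zero]
    | ht c c' => rfl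
    | ha x y hx hy => rw [smul_add, map_add, map_add, hx, hy]
  rw [← h, ← BimodHom.map_smul_right, Coring.comul_counit]

theorem LeftDual.unitHom_mul_toLin (a : A) (ξ : LeftDual A C) (c : C) :
    (LeftDual.unitHom A C a * ξ).toLin c = ξ.toLin (op a • c) :=
  congrArg ξ.toLin (LeftDual.contractRight_unitFun a c)

theorem LeftDual.mul_unitHom_toLin (a : A) (ξ : LeftDual A C) (c : C) :
    (ξ * LeftDual.unitHom A C a).toLin c = ξ.toLin c * a := by
  rw [← LeftDual.counit_contractRight ξ c]
  exact (Coring.counit (A := A) (C := C)).map_smul_right a _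

/-- The left dual ring as an extension of the base ring. -/
abbrev LeftDualExt (A C : Type*) [Ring A] [AddCommGroup C] [Module A C] [Module Aᵐᵒᵖ C]
    [SMulCommClass A Aᵐᵒᵖ C] [Coring A C] : Type _ :=
  ExtRing (LeftDual.unitHom A C)

/-- An element of the extension ring as a linear map. -/
def LeftDualExt.toLin (ξ : LeftDualExt A C) : C →ₗ[A] A := ξ

/-- `ξ ⊗ ξ' ↦ (c ⊗ c' ↦ ξ'(c ξ(c')))` -/
def LeftDual.pairing : Tens A (LeftDualExt A C) (LeftDualExt A C) →+ (Tens A C C →ₗ[A] A) :=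
  Tens.lift
    (Tens.biadd (fun ξ ξ' : LeftDualExt A C => ξ'.toLin ∘ₗ contractRightLin ξ.toLin)
      (fun ξ η ζ => by
        -- Passing to additive maps reduces an equality of functionals to pure tensors.
        refine LinearMap.toAddMonoidHom_injective (Tens.hom_ext fun c c' => ?_)
        change ζ.toLin (op (ξ.toLin c' + η.toLin c') • c) = _
        rw [op_add, add_smul, map_add]
        rfl)
      (fun ξ η ζ => rfl))
    (fun ξ a η => by
      -- Balancedness: both sides send `c ⊗ c'` to `η(c ξ(c') a)`.
      refine LinearMap.toAddMonoidHom_injective (Tens.hom_ext fun c c' => ?_)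
      refine (congrArg (fun t => η.toLin (op t • c))
        (LeftDual.mul_unitHom_toLin a ξ c')).trans ?_
      refine Eq.trans ?_ (LeftDual.unitHom_mul_toLin a η _).symm
      rw [op_mul, mul_smul]
      rfl)

/-- The product of `*C` is by definition the pairing composed with `Δ`. Hence an element multiplies
to `1` exactly when its functional restricts to `ε` along `Δ`. -/
theorem LeftDual.mulMap_toLin (x : Tens A (LeftDualExt A C) (LeftDualExt A C)) (c : C) :
    LeftDualExt.toLin (ExtRing.mulMap _ x) c =
      LeftDual.pairing x (Coring.comul (A := A) c) := by
  induction x using Tens.induction_on with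
  | h0 => rw [map_zero, map_zero]; rfl
  | ht ξ η => rfl
  | ha x y hx hy =>
    rw [map_add, map_add, LinearMap.add_apply, ← hx, ← hy]
    rfl

/-- Left multiplication by `b` changes only the first tensor factor `ξ`, which is evaluated at `c'`.
-/
theorem LeftDual.pairing_left_smul (b : LeftDualExt A C)
    (x : Tens A (LeftDualExt A C) (LeftDualExt A C)) (c c' : C) :
    LeftDual.pairing (b • x) (Tens.tmul A c c') =
      LeftDual.pairing x
        (Tens.tmul A c (Tens.contractRight b.toLin (Coring.comul (A := A) c'))) := by
  induction x using Tens.induction_on with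
  | h0 => rw [smul_zero, map_zero]; rfl
  | ht ξ η => rfl
  | ha x y hx hy =>
    rw [smul_add, map_add, map_add, LinearMap.add_apply, LinearMap.add_apply, hx, hy]

/-- For `x = ξ ⊗ η`, the product `η b` is evaluated at `c ξ(c')`. Right linearity of `Δ` puts
`ξ(c')` inside the argument of `η`, which produces the slice of the pairing at `c'`. -/
theorem LeftDual.pairing_right_smul (b : LeftDualExt A C)
    (x : Tens A (LeftDualExt A C) (LeftDualExt A C)) (c c' : C) :
    LeftDual.pairing (op b • x) (Tens.tmul A c c') =
      b.toLin (Tens.contractRight (sliceLeft (LeftDual.pairing x) c')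
        (Coring.comul (A := A) c)) := by
  induction x using Tens.induction_on with
  | h0 =>
    have h : Tens.contractRight (M := C) (sliceLeft (0 : Tens A C C →ₗ[A] A) c') = 0 :=
      Tens.hom_ext fun m n => by simp
    rw [smul_zero, map_zero, h, AddMonoidHom.zero_apply, map_zero, LinearMap.zero_apply]
  | ht ξ η =>
    change b.toLin (Tens.contractRight η.toLin (Coring.comul (A := A) (op (ξ.toLin c') • c))) = _
    rw [BimodHom.map_smul_right]
    congr 1
    generalize Coring.comul (A := A) c = y
    induction y using Tens.induction_on with
    | h0 => rw [smul_zero, map_zero, map_zero]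
    | ht d d' => rfl
    | ha x y hx hy => rw [smul_add, map_add, map_add, hx, hy]
  | ha x y hx hy =>
    have h : Tens.contractRight (M := C)
        (sliceLeft (LeftDual.pairing x + LeftDual.pairing y) c') =
        Tens.contractRight (sliceLeft (LeftDual.pairing x) c') +
          Tens.contractRight (sliceLeft (LeftDual.pairing y) c') :=
      Tens.hom_ext fun m n => by simp [add_smul]
    rw [smul_add, map_add, map_add, LinearMap.add_apply, hx, hy, h, AddMonoidHom.add_apply,
      map_add]

section FiniteProjective

variable [Module.Finite A C] [Module.Projective A C]

-- For a dual basis `e i`, `f i` the inverse is `F ↦ ∑ f i ⊗ F(- ⊗ e i)`. One composite is the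
-- identity because `∑ f i · ξ(e i) = ξ`, the other because `c' = ∑ f i(c') e i`.
variable (A C) in
theorem LeftDual.pairing_bijective : Function.Bijective (LeftDual.pairing (A := A) (C := C)) := by
  obtain ⟨n, e, f, hef⟩ := exists_finite_dual_basis A C
  let g (i : Fin n) : LeftDualExt A C := f i
  let s (F : Tens A C C →ₗ[A] A) (i : Fin n) : LeftDualExt A C := sliceLeft F (e i)
  refine Function.bijective_iff_has_inverse.2
    ⟨fun F => ∑ i, Tens.tmul A (g i) (s F i), fun x => ?_, fun F => ?_⟩
  · change ∑ i, Tens.tmul A (g i) (s (LeftDual.pairing x) i) = x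
    induction x using Tens.induction_on with
    | h0 =>
      refine Finset.sum_eq_zero fun i _ => ?_
      rw [map_zero]
      exact Tens.tmul_zero _
    | ht ξ η =>
      have h : ∀ i, s (LeftDual.pairing (Tens.tmul A ξ η)) i = ξ.toLin (e i) • η := fun i =>
        LeftDual.ext fun c => (LeftDual.unitHom_mul_toLin (ξ.toLin (e i)) η c).symm
      -- The scalar `ξ(e i)` moves across the tensor sign to `f i`, where the sum reassembles `ξ`.
      simp only [h, ← Tens.smul_tmul]
      have h' : ∑ i, op (ξ.toLin (e i)) • g i = ξ := LeftDual.ext fun c => by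
        have h1 : ∀ i, LeftDualExt.toLin (op (ξ.toLin (e i)) • g i) c =
            f i c * ξ.toLin (e i) := fun i =>
          LeftDual.mul_unitHom_toLin (ξ.toLin (e i)) (f i) c
        change (∑ i, LeftDualExt.toLin (op (ξ.toLin (e i)) • g i)) c = ξ.toLin c
        rw [LinearMap.sum_apply]
        conv_rhs => rw [← hef c, map_sum]
        exact Finset.sum_congr rfl fun i _ => by rw [h1, map_smul, smul_eq_mul]
      conv_rhs => rw [← h']
      exact (map_sum ((Tens.tmulHom A (LeftDualExt A C) (LeftDualExt A C)).flip η) _ _).symm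
    | ha x y hx hy =>
      conv_rhs => rw [← hx, ← hy, ← Finset.sum_add_distrib]
      refine Finset.sum_congr rfl fun i _ => ?_
      rw [← Tens.tmul_add, map_add]
      rfl
  · refine LinearMap.toAddMonoidHom_injective (Tens.hom_ext fun c c' => ?_)
    change LeftDual.pairing (∑ i, Tens.tmul A (g i) (s F i)) (Tens.tmul A c c') =
      F (Tens.tmul A c c')
    rw [map_sum, LinearMap.sum_apply]
    have h : Tens.tmul A c c' = ∑ i, Tens.tmul A c (f i c' • e i) := by
      conv_lhs => rw [← hef c']
      exact map_sum (Tens.tmulHom A C C c) _ _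
    conv_rhs => rw [h, map_sum]
    refine Finset.sum_congr rfl fun i _ => ?_
    rw [← Tens.smul_tmul]
    rfl

variable (A C) in
/-- Coseparability is separability of the left dual ring. -/
theorem isCoseparable_iff_leftDual :
    IsCoseparable A C ↔ IsSeparableExtension (LeftDual.unitHom A C) := by
  rw [isCoseparable_iff_exists_isCointegral, isSeparableExtension_iff]
  constructor
  · rintro ⟨γ, hγ⟩
    -- Surjectivity produces the Casimir element; injectivity then lets its centrality be tested on
    -- functionals.
    obtain ⟨x, hx⟩ := (LeftDual.pairing_bijective A C).2 γ.left
    refine ⟨x, LeftDual.ext fun c => ?_, fun b => (LeftDual.pairing_bijective A C).1 ?_⟩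
    · have h := LeftDual.mulMap_toLin x c
      rw [hx] at h
      exact h.trans (hγ.apply_comul c)
    · refine LinearMap.toAddMonoidHom_injective (Tens.hom_ext fun c c' => ?_)
      change LeftDual.pairing (b • x) (Tens.tmul A c c') =
        LeftDual.pairing (op b • x) (Tens.tmul A c c')
      rw [LeftDual.pairing_left_smul, LeftDual.pairing_right_smul, hx, hγ.balance]
      -- What remains is `γ(c ⊗ d b(d')) = b(γ(c ⊗ d) d')`: right linearity of `γ` against left
      -- linearity of `b`.
      generalize Coring.comul (A := A) c' = y
      induction y using Tens.induction_on with
      | h0 => simp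
      | ht d d' =>
        refine (γ.map_smul_right (b.toLin d') (Tens.tmul A c d)).trans ?_
        exact (b.toLin.map_smul (γ (Tens.tmul A c d)) d').symm
      | ha x y hx hy => rw [map_add, map_add, map_add, Tens.tmul_add, map_add, hx, hy]
  · rintro ⟨x, hx, hc⟩
    have key (b : LeftDualExt A C) (c c' : C) : LeftDual.pairing x
          (Tens.tmul A c (Tens.contractRight b.toLin (Coring.comul (A := A) c'))) =
        b.toLin (Tens.contractRight (sliceLeft (LeftDual.pairing x) c')
          (Coring.comul (A := A) c)) := by
      rw [← LeftDual.pairing_left_smul, hc, LeftDual.pairing_right_smul]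
    -- The functional is only left linear by construction. Centrality against `b = *ι(a)` gives
    -- right linearity: the left side of `key` becomes the value at `c ⊗ c' a`, the right side the
    -- value at `c ⊗ c'` times `a`.
    have hr (a : A) (z : Tens A C C) :
        LeftDual.pairing x (op a • z) = op a • LeftDual.pairing x z := by
      induction z using Tens.induction_on with
      | h0 => rw [smul_zero, map_zero, smul_zero]
      | ht c c' =>
        have h := key (LeftDual.unitFun A C a) c c'
        have h' := LeftDual.counit_contractRight (sliceLeft (LeftDual.pairing x) c') c
        refine (congrArg (fun d => LeftDual.pairing x (Tens.tmul A c d))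
          (LeftDual.contractRight_unitFun a c').symm).trans (h.trans ?_)
        refine ((Coring.counit (A := A) (C := C)).map_smul_right a _).trans ?_
        exact congrArg (fun d => op a • d) h'
      | ha y z hy hz => rw [smul_add, map_add, map_add, smul_add, hy, hz]
    refine ⟨{ (LeftDual.pairing x).toAddMonoidHom with
              map_left_smul := (LeftDual.pairing x).map_smul
              map_right_smul := hr }, fun c => ?_, fun c c' => ?_⟩
    · refine (LeftDual.mulMap_toLin x c).symm.trans ?_
      rw [hx]
      rfl
    · obtain ⟨n, e, f, hef⟩ := exists_finite_dual_basis A C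
      -- Balance is an equality in `C`, so it is enough to compare coordinates, that is, to use
      -- `key` with `b = f i`.
      rw [← hef (Tens.contractRight _ _), ← hef (Tens.contractLeft _ _)]
      refine Finset.sum_congr rfl fun i _ => congrArg (fun a => a • e i) ?_
      refine (key (f i) c c').symm.trans ?_
      generalize Coring.comul (A := A) c' = y
      induction y using Tens.induction_on with
      | h0 => simp
      | ht d d' =>
        refine (hr (f i d') (Tens.tmul A c d)).trans ?_
        exact ((f i).map_smul (LeftDual.pairing x (Tens.tmul A c d)) d').symm
      | ha x y hx hy => rw [map_add, Tens.tmul_add, map_add, map_add, map_add, hx, hy]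

end FiniteProjective

/-! ### The right dual -/

theorem RightDual.counit_contractLeft (ξ : RightDual A C) (c : C) :
    Coring.counit (A := A) (Tens.contractLeft ξ.toLin (Coring.comul (A := A) c)) =
      ξ.toLin c :=
  congrArg (fun η : RightDual A C => η.toLin c) (one_mul ξ)

theorem RightDual.contractLeft_unitFun (a : A) (c : C) :
    Tens.contractLeft (RightDual.unitFun A C a) (Coring.comul (A := A) c) = a • c := by
  have h : ∀ x : Tens A C C,
      Tens.contractLeft (Coring.counit (A := A) (C := C)).right (a • x) =
        Tens.contractLeft (RightDual.unitFun A C a) x := fun x => by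
    induction x using Tens.induction_on with
    | h0 => rw [smul_zero, map_zero, map_zero]
    | ht c c' => rfl
    | ha x y hx hy => rw [smul_add, map_add, map_add, hx, hy]
  rw [← h, ← BimodHom.map_smul_left, Coring.counit_comul]

/-- Together with `RightDual.unitHom_mul_toLin` this describes the `A`-bimodule structure of `C*`,
which makes the pairing balanced. -/
theorem RightDual.mul_unitHom_toLin (a : A) (ξ : RightDual A C) (c : C) :
    (ξ * RightDual.unitHom A C a).toLin c = ξ.toLin (a • c) :=
  congrArg ξ.toLin (RightDual.contractLeft_unitFun a c)

theorem RightDual.unitHom_mul_toLin (a : A) (ξ : RightDual A C) (c : C) :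
    (RightDual.unitHom A C a * ξ).toLin c = a * ξ.toLin c := by
  rw [← RightDual.counit_contractLeft ξ c]
  exact (Coring.counit (A := A) (C := C)).map_smul_left a _

/-- The right dual ring as an extension of the base ring. -/
abbrev RightDualExt (A C : Type*) [Ring A] [AddCommGroup C] [Module A C] [Module Aᵐᵒᵖ C]
    [SMulCommClass A Aᵐᵒᵖ C] [Coring A C] : Type _ :=
  ExtRing (RightDual.unitHom A C)

/-- An element of the extension ring as a linear map. -/
def RightDualExt.toLin (ξ : RightDualExt A C) : C →ₗ[Aᵐᵒᵖ] A := ξ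

/-- `ξ ⊗ ξ' ↦ (c ⊗ c' ↦ ξ(ξ'(c) c'))` -/
def RightDual.pairing :
    Tens A (RightDualExt A C) (RightDualExt A C) →+ (Tens A C C →ₗ[Aᵐᵒᵖ] A) :=
  Tens.lift
    (Tens.biadd (fun ξ ξ' : RightDualExt A C => ξ.toLin ∘ₗ contractLeftLin ξ'.toLin)
      (fun ξ η ζ => rfl)
      (fun ξ η ζ => by
        refine LinearMap.toAddMonoidHom_injective (Tens.hom_ext fun c c' => ?_)
        change ξ.toLin ((η.toLin c + ζ.toLin c) • c') = _
        rw [add_smul, map_add]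
        rfl))
    (fun ξ a η => by
      refine LinearMap.toAddMonoidHom_injective (Tens.hom_ext fun c c' => ?_)
      refine (RightDual.mul_unitHom_toLin a ξ _).trans ?_
      refine Eq.trans ?_ (congrArg (fun t => ξ.toLin (t • c'))
        (RightDual.unitHom_mul_toLin a η c)).symm
      rw [mul_smul]
      rfl)

theorem RightDual.mulMap_toLin (x : Tens A (RightDualExt A C) (RightDualExt A C)) (c : C) :
    RightDualExt.toLin (ExtRing.mulMap _ x) c =
      RightDual.pairing x (Coring.comul (A := A) c) := by
  induction x using Tens.induction_on with
  | h0 => rw [map_zero, map_zero]; rfl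
  | ht ξ η => rfl
  | ha x y hx hy =>
    rw [map_add, map_add, LinearMap.add_apply, ← hx, ← hy]
    rfl

/-- Compared with `*C` the two actions exchange roles: right multiplication changes the factor
evaluated at `c`, and left multiplication is the one that produces a slice. -/
theorem RightDual.pairing_right_smul (b : RightDualExt A C)
    (x : Tens A (RightDualExt A C) (RightDualExt A C)) (c c' : C) :
    RightDual.pairing (op b • x) (Tens.tmul A c c') =
      RightDual.pairing x
        (Tens.tmul A (Tens.contractLeft b.toLin (Coring.comul (A := A) c)) c') := by
  induction x using Tens.induction_on with
  | h0 => rw [smul_zero, map_zero]; rfl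
  | ht ξ η => rfl
  | ha x y hx hy =>
    rw [smul_add, map_add, map_add, LinearMap.add_apply, LinearMap.add_apply, hx, hy]

theorem RightDual.pairing_left_smul (b : RightDualExt A C)
    (x : Tens A (RightDualExt A C) (RightDualExt A C)) (c c' : C) :
    RightDual.pairing (b • x) (Tens.tmul A c c') =
      b.toLin (Tens.contractLeft (sliceRight (RightDual.pairing x) c)
        (Coring.comul (A := A) c')) := by
  induction x using Tens.induction_on with
  | h0 =>
    have h : Tens.contractLeft (M := C) (sliceRight (0 : Tens A C C →ₗ[Aᵐᵒᵖ] A) c) = 0 :=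
      Tens.hom_ext fun m n => by simp
    rw [smul_zero, map_zero, h, AddMonoidHom.zero_apply, map_zero, LinearMap.zero_apply]
  | ht ξ η =>
    change b.toLin (Tens.contractLeft ξ.toLin (Coring.comul (A := A) (η.toLin c • c'))) = _
    rw [BimodHom.map_smul_left]
    congr 1
    generalize Coring.comul (A := A) c' = y
    induction y using Tens.induction_on with
    | h0 => rw [smul_zero, map_zero, map_zero]
    | ht d d' => rfl
    | ha x y hx hy => rw [smul_add, map_add, map_add, hx, hy]
  | ha x y hx hy =>
    have h : Tens.contractLeft (M := C)
        (sliceRight (RightDual.pairing x + RightDual.pairing y) c) =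
        Tens.contractLeft (sliceRight (RightDual.pairing x) c) +
          Tens.contractLeft (sliceRight (RightDual.pairing y) c) :=
      Tens.hom_ext fun m n => by simp [add_smul]
    rw [smul_add, map_add, map_add, LinearMap.add_apply, hx, hy, h, AddMonoidHom.add_apply,
      map_add]

section FiniteProjective

variable [Module.Finite Aᵐᵒᵖ C] [Module.Projective Aᵐᵒᵖ C]

-- The inverse is `F ↦ ∑ F(e i ⊗ -) ⊗ f i`, with the expansion now made in the first factor `c`.
variable (A C) in
theorem RightDual.pairing_bijective :
    Function.Bijective (RightDual.pairing (A := A) (C := C)) := by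
  obtain ⟨n, e, f, hef⟩ := exists_finite_right_dual_basis A C
  let g (i : Fin n) : RightDualExt A C := f i
  let s (F : Tens A C C →ₗ[Aᵐᵒᵖ] A) (i : Fin n) : RightDualExt A C := sliceRight F (e i)
  refine Function.bijective_iff_has_inverse.2
    ⟨fun F => ∑ i, Tens.tmul A (s F i) (g i), fun x => ?_, fun F => ?_⟩
  · change ∑ i, Tens.tmul A (s (RightDual.pairing x) i) (g i) = x
    induction x using Tens.induction_on with
    | h0 =>
      refine Finset.sum_eq_zero fun i _ => ?_
      rw [map_zero]
      exact Tens.zero_tmul _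
    | ht ξ η =>
      have h : ∀ i, s (RightDual.pairing (Tens.tmul A ξ η)) i = op (η.toLin (e i)) • ξ :=
        fun i => RightDual.ext fun c =>
          (RightDual.mul_unitHom_toLin (η.toLin (e i)) ξ c).symm
      simp only [h, Tens.smul_tmul]
      have h' : ∑ i, η.toLin (e i) • g i = η := RightDual.ext fun c => by
        have h1 : ∀ i, RightDualExt.toLin (η.toLin (e i) • g i) c =
            η.toLin (e i) * f i c := fun i =>
          RightDual.unitHom_mul_toLin (η.toLin (e i)) (f i) c
        change (∑ i, RightDualExt.toLin (η.toLin (e i) • g i)) c = η.toLin c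
        rw [LinearMap.sum_apply]
        conv_rhs => rw [← hef c, map_sum]
        exact Finset.sum_congr rfl fun i _ => by rw [h1, map_smul, op_smul_eq_mul]
      conv_rhs => rw [← h']
      exact (map_sum (Tens.tmulHom A (RightDualExt A C) (RightDualExt A C) ξ) _ _).symm
    | ha x y hx hy =>
      conv_rhs => rw [← hx, ← hy, ← Finset.sum_add_distrib]
      refine Finset.sum_congr rfl fun i _ => ?_
      rw [← Tens.add_tmul, map_add]
      rfl
  · refine LinearMap.toAddMonoidHom_injective (Tens.hom_ext fun c c' => ?_)
    change RightDual.pairing (∑ i, Tens.tmul A (s F i) (g i)) (Tens.tmul A c c') =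
      F (Tens.tmul A c c')
    rw [map_sum, LinearMap.sum_apply]
    have h : Tens.tmul A c c' = ∑ i, Tens.tmul A (op (f i c) • e i) c' := by
      conv_lhs => rw [← hef c]
      exact map_sum ((Tens.tmulHom A C C).flip c') _ _
    conv_rhs => rw [h, map_sum]
    refine Finset.sum_congr rfl fun i _ => ?_
    rw [Tens.smul_tmul]
    rfl

variable (A C) in
/-- Coseparability is separability of the right dual ring. -/
theorem isCoseparable_iff_rightDual :
    IsCoseparable A C ↔ IsSeparableExtension (RightDual.unitHom A C) := by
  rw [isCoseparable_iff_exists_isCointegral, isSeparableExtension_iff]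
  constructor
  · rintro ⟨γ, hγ⟩
    obtain ⟨x, hx⟩ := (RightDual.pairing_bijective A C).2 γ.right
    refine ⟨x, RightDual.ext fun c => ?_, fun b => (RightDual.pairing_bijective A C).1 ?_⟩
    · have h := RightDual.mulMap_toLin x c
      rw [hx] at h
      exact h.trans (hγ.apply_comul c)
    · refine LinearMap.toAddMonoidHom_injective (Tens.hom_ext fun c c' => ?_)
      change RightDual.pairing (b • x) (Tens.tmul A c c') =
        RightDual.pairing (op b • x) (Tens.tmul A c c')
      rw [RightDual.pairing_left_smul, RightDual.pairing_right_smul, hx, ← hγ.balance]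
      -- Balance was used from right to left, so what remains is `b(d γ(d' ⊗ c')) = γ(b(d) d' ⊗
      -- c')`.
      generalize Coring.comul (A := A) c = y
      induction y using Tens.induction_on with
      | h0 => simp
      | ht d d' =>
        refine (b.toLin.map_smul (op (γ (Tens.tmul A d' c'))) d).trans ?_
        exact (γ.map_smul_left (b.toLin d) (Tens.tmul A d' c')).symm
      | ha x y hx hy => rw [map_add, map_add, map_add, Tens.add_tmul, map_add, hx, hy]
  · rintro ⟨x, hx, hc⟩
    have key (b : RightDualExt A C) (c c' : C) : RightDual.pairing x
          (Tens.tmul A (Tens.contractLeft b.toLin (Coring.comul (A := A) c)) c') =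
        b.toLin (Tens.contractLeft (sliceRight (RightDual.pairing x) c)
          (Coring.comul (A := A) c')) := by
      rw [← RightDual.pairing_right_smul, ← hc, RightDual.pairing_left_smul]
    -- Here right linearity is built in, and centrality against `b = ι*(a)` supplies left linearity.
    have hl (a : A) (z : Tens A C C) :
        RightDual.pairing x (a • z) = a • RightDual.pairing x z := by
      induction z using Tens.induction_on with
      | h0 => rw [smul_zero, map_zero, smul_zero]
      | ht c c' =>
        have h := key (RightDual.unitFun A C a) c c'
        have h' := RightDual.counit_contractLeft (sliceRight (RightDual.pairing x) c) c'
        refine (congrArg (fun d => RightDual.pairing x (Tens.tmul A d c'))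
          (RightDual.contractLeft_unitFun a c).symm).trans (h.trans ?_)
        refine ((Coring.counit (A := A) (C := C)).map_smul_left a _).trans ?_
        exact congrArg (fun d => a • d) h'
      | ha y z hy hz => rw [smul_add, map_add, map_add, smul_add, hy, hz]
    refine ⟨{ (RightDual.pairing x).toAddMonoidHom with
              map_left_smul := hl
              map_right_smul := fun a => (RightDual.pairing x).map_smul (op a) },
            fun c => ?_, fun c c' => ?_⟩
    · refine (RightDual.mulMap_toLin x c).symm.trans ?_
      rw [hx]
      rfl
    · obtain ⟨n, e, f, hef⟩ := exists_finite_right_dual_basis A C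
      rw [← hef (Tens.contractRight _ _), ← hef (Tens.contractLeft _ _)]
      refine Finset.sum_congr rfl fun i _ => congrArg (fun a => op a • e i) ?_
      refine Eq.trans ?_ (key (f i) c c')
      generalize Coring.comul (A := A) c = y
      induction y using Tens.induction_on with
      | h0 => simp
      | ht d d' =>
        refine ((f i).map_smul (op (RightDual.pairing x (Tens.tmul A d' c'))) d).trans ?_
        exact (hl (f i d) (Tens.tmul A d' c')).symm
      | ha x y hx hy => rw [map_add, map_add, map_add, Tens.add_tmul, map_add, hx, hy]

end FiniteProjective

end Pairing

end Corings

end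

theorem mainTheorem8 {A : Type*} {C : Type*} [Ring A] [AddCommGroup C] [Module A C]
    [Module Aᵐᵒᵖ C] [SMulCommClass A Aᵐᵒᵖ C] [Corings.Coring A C] :
    (Module.Finite A C → Module.Projective A C →
      (Corings.IsCoseparable A C ↔
        Corings.IsSeparableExtension (Corings.LeftDual.unitHom A C))) ∧
    (Module.Finite Aᵐᵒᵖ C → Module.Projective Aᵐᵒᵖ C →
      (Corings.IsCoseparable A C ↔
        Corings.IsSeparableExtension (Corings.RightDual.unitHom A C))) := by
  exact ⟨fun _ _ => Corings.isCoseparable_iff_leftDual A C,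
    fun _ _ => Corings.isCoseparable_iff_rightDual A C⟩
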